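/- Consider a network with $B\ge 2$ base stations (BSs) $\mathcal B=\{1,\dots,B\}$, where BS $i$ has $m_i\ge 1$ radio frequency chains. Users arrive in a Poisson process of rate $\lambda>0$, and each has a file whose size is exponentially distributed with parameter $\mu>0$ (file sizes, arrivals and locations being independent). An arriving user is located in the cell of BS $i$ with probability $p_i\ge 0$, where $\sum_{i}p_i=1$. A user in the cell of BS $k$ gets data rate $c_2$ with BS $k$ and data rate $c_1=1$ with every other BS, where $c_2>c_1$. A user associated with BS $i$ at data rate $r$ has throughput $\min(m_i,X_i)\,r/X_i$, where $X_i$ is the current number of users associated with BS $i$, and it leaves when its file is transmitted. Under the SNR based policy, an arriving user joins a BS with which it has the highest data rate, ties being broken uniformly at random. Let $X_{ir}$ be the number of users associated with BS $i$ at rate $c_r$ ($r=1,2$), so $X_i=X_{i1}+X_{i2}$. The matrix $s=(X_{ir})_{i\in\mathcal B,\,r\in\{1,2\}}$ evolves as a continuous-time Markov chain in which $X_{ir}$ increases by one at rate $\lambda$ times the probability that an arriving user joins BS $i$ at rate $c_r$, and, if $X_{ir}>0$, decreases by one at rate $\mu\min(m_i,X_i)\,\frac{X_{ir}c_r}{X_i}$.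 The system is called stable if this chain, on the set of states that can be reached from the empty state, is positive recurrent, i.e. the expected return time to each of these states is finite. Theorem. Under the SNR based policy, the system is stable if and only if $$\lambda<\mu\,c_2\,\min_{i\in\mathcal B}\frac{m_i}{p_i},$$ where $m_i/p_i=+\infty$ if $p_i=0$. -/

import Mathlib

open MeasureTheory ProbabilityTheory
open scoped ENNReal

/-! ## Continuous-time Markov chains on a countable state space -/

/-- Off-diagonal transition rates of a continuous-time Markov chain on `S`, such that every state
has a positive and finite total exit rate. -/
structure TransitionRates (S : Type*) where
  rate : S → S → ℝ≥0∞
  rate_self : ∀ s, rate s s = 0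
  exit_ne_zero : ∀ s, ∑' s', rate s s' ≠ 0
  exit_ne_top : ∀ s, ∑' s', rate s s' ≠ ∞

namespace TransitionRates

variable {S : Type*} (Q : TransitionRates S)

/-- The total transition rate out of a state. -/
noncomputable def exitRate (s : S) : ℝ := (∑' s', Q.rate s s').toReal

theorem exitRate_pos (s : S) : 0 < Q.exitRate s :=
  ENNReal.toReal_pos (Q.exit_ne_zero s) (Q.exit_ne_top s)

/-- Transition probabilities of the embedded discrete-time chain: the probability of jumping from
`s` to `s'` is `rate s s'` divided by the total rate out of `s`. -/
noncomputable def embedded (s : S) : PMF S :=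
  PMF.normalize (Q.rate s) (Q.exit_ne_zero s) (Q.exit_ne_top s)

/-- `s'` can be reached from `s` in finitely many (possibly zero) transitions. -/
def Reachable (s s' : S) : Prop :=
  Relation.ReflTransGen (fun a b => Q.rate a b ≠ 0) s s'

variable [MeasurableSpace S] [Countable S] [MeasurableSingletonClass S]

/-- The transition kernel of the embedded chain. -/
noncomputable def jumpKernel : Kernel S S :=
  Kernel.ofFunOfCountable fun s => (Q.embedded s).toMeasure

instance : IsMarkovKernel Q.jumpKernel :=
  ⟨fun s => PMF.toMeasure.isProbabilityMeasure (Q.embedded s)⟩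

/-- The holding time in a state is exponential, with parameter the total rate out of it. -/
noncomputable def holdingKernel : Kernel S ℝ :=
  Kernel.ofFunOfCountable fun s => expMeasure (Q.exitRate s)

instance : IsMarkovKernel Q.holdingKernel :=
  ⟨fun s => isProbabilityMeasure_expMeasure (Q.exitRate_pos s)⟩

/-- One step of the chain of pairs (visited state, holding time in it): choose the next state by the
embedded chain, then an exponential holding time in that state. -/
noncomputable def stepKernel : Kernel (S × ℝ) (S × ℝ) :=
  ((Kernel.id ×ₖ Q.holdingKernel) ∘ₖ Q.jumpKernel).comap Prod.fst measurable_fst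

instance : IsMarkovKernel Q.stepKernel := by
  unfold stepKernel; infer_instance

/-- The one-step kernels as functions of the whole past (they depend only on the last pair). -/
noncomputable def historyKernel (n : ℕ) :
    Kernel ((i : Finset.Iic n) → (fun _ : ℕ => S × ℝ) i) ((fun _ : ℕ => S × ℝ) (n + 1)) :=
  Q.stepKernel.comap (fun x => x ⟨n, Finset.mem_Iic.2 le_rfl⟩) (measurable_pi_apply _)

instance (n : ℕ) : IsMarkovKernel (Q.historyKernel n) := by
  unfold historyKernel; infer_instance

/-- The law of the continuous-time chain started at `s`, as a law on the sequences of pairs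
(`k`-th visited state, holding time of the `k`-th visit). -/
noncomputable def pathLaw (s : S) : Measure (ℕ → S × ℝ) :=
  Kernel.trajMeasure (X := fun _ : ℕ => S × ℝ)
    ((Measure.dirac s).prod (Q.holdingKernel s)) Q.historyKernel

/-- The first time at which the chain re-enters `s` by a transition: the sum of the holding times of
all earlier visits, and `∞` if `s` is never re-entered. (The sums increase with `n`, so the infimum
is attained at the first `n ≥ 1` at which the embedded chain is at `s`.) -/
noncomputable def returnTime (s : S) (ω : ℕ → S × ℝ) : ℝ≥0∞ :=
  ⨅ (n : ℕ) (_ : 1 ≤ n ∧ (ω n).1 = s), ∑ k ∈ Finset.range n, ENNReal.ofReal (ω k).2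

/-- A state is positive recurrent if the expected time of the first return to it is finite. -/
def PositiveRecurrent (s : S) : Prop :=
  ∫⁻ ω, returnTime s ω ∂(Q.pathLaw s) < ∞

/-- The chain which starts in `s₀`, and thus has as its state space the states that can be reached
from `s₀`, is positive recurrent. -/
def IsPositiveRecurrentFrom (s₀ : S) : Prop :=
  ∀ s, Q.Reachable s₀ s → Q.PositiveRecurrent s

end TransitionRates

/-! ## The network -/

/-- The parameters of the network with `B` base stations (BSs). -/
structure Network (B : ℕ) where
  /-- users arrive in a Poisson process of rate `lam` -/
  lam : ℝ
  /-- file sizes are exponential with parameter `μ` -/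
  μ : ℝ
  /-- the data rate of a line-of-sight link (it is `1` for the other links) -/
  c₂ : ℝ
  /-- the number of RF chains of each BS -/
  m : Fin B → ℕ
  /-- the probability that an arriving user is in the cell of a given BS -/
  p : Fin B → ℝ
  lam_pos : 0 < lam
  μ_pos : 0 < μ
  one_lt_c₂ : 1 < c₂
  one_le_m : ∀ i, 1 ≤ m i
  p_nonneg : ∀ i, 0 ≤ p i
  sum_p : ∑ i, p i = 1

/-- A state: the entry `s i r` is the number of users associated with BS `i` at rate `c₁` (`r = 0`)
or `c₂` (`r = 1`). -/
abbrev NetworkState (B : ℕ) := Fin B → Fin 2 → ℕ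

/-- A user association policy: given the current state and the rate vector of an arriving user
(entry `i` is the data rate that it would get with BS `i`), the law of the BS it joins. -/
abbrev AssociationPolicy (B : ℕ) := NetworkState B → (Fin B → ℝ) → PMF (Fin B)

/-- The SNR based policy: join a BS with the highest data rate, ties being broken uniformly. -/
noncomputable def snrPolicy (B : ℕ) [NeZero B] : AssociationPolicy B := fun _ R =>
  PMF.uniformOfFinset (Finset.univ.filter fun a => ∀ i, R i ≤ R a) <| by
    obtain ⟨a, -, ha⟩ := Finset.exists_max_image Finset.univ R Finset.univ_nonempty
    exact ⟨a, by simpa using ha⟩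

/-- The state with a single user, associated with BS `i` at rate number `r`. -/
def oneUser {B : ℕ} (i : Fin B) (r : Fin 2) : NetworkState B := Pi.single i (Pi.single r 1)

namespace Network

variable {B : ℕ} (N : Network B)

/-- The two data rates `c₁ = 1` and `c₂`. -/
noncomputable def dataRate : Fin 2 → ℝ := ![1, N.c₂]

/-- The rate vector of a user in the cell of BS `k`. -/
noncomputable def rateVector (k : Fin B) : Fin B → ℝ :=
  fun i => if i = k then N.dataRate 1 else N.dataRate 0

/-- The throughput of a user associated with BS `i` at rate number `r`. -/
noncomputable def throughput (s : NetworkState B) (i : Fin B) (r : Fin 2) : ℝ :=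
  (min (N.m i) (s i 0 + s i 1) : ℕ) * (N.dataRate r / (s i 0 + s i 1 : ℕ))

/-- The probability that a user who arrives in state `s` joins BS `i` at rate number `r`. -/
noncomputable def joinProb (π : AssociationPolicy B) (s : NetworkState B) (i : Fin B) (r : Fin 2) :
    ℝ≥0∞ :=
  ∑ k, ENNReal.ofReal (N.p k) *
    (if N.rateVector k i = N.dataRate r then π s (N.rateVector k) i else 0)

/-- The rate of arrivals of users who join BS `i` at rate number `r`. -/
noncomputable def arrivalRate (π : AssociationPolicy B) (s : NetworkState B) (i : Fin B)
    (r : Fin 2) : ℝ≥0∞ :=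
  ENNReal.ofReal N.lam * N.joinProb π s i r

/-- The rate of departures of users associated with BS `i` at rate number `r` (it is `0` if there
are none). -/
noncomputable def departureRate (s : NetworkState B) (i : Fin B) (r : Fin 2) : ℝ≥0∞ :=
  ENNReal.ofReal (N.μ * (s i r * N.throughput s i r))

/-- The rate of transitions from `s` to `s'`: a user joins some BS at some rate, or a user leaves. -/
noncomputable def transitionRate (π : AssociationPolicy B) (s s' : NetworkState B) : ℝ≥0∞ :=
  ∑ i, ∑ r, ((if s' = s + oneUser i r then N.arrivalRate π s i r else 0) +
    (if s = s' + oneUser i r then N.departureRate s i r else 0))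

theorem oneUser_ne_zero (i : Fin B) (r : Fin 2) : oneUser i r ≠ 0 := by
  intro h
  have := congrFun (congrFun h i) r
  simp [oneUser] at this

theorem transitionRate_self (π : AssociationPolicy B) (s : NetworkState B) :
    N.transitionRate π s s = 0 := by
  refine Finset.sum_eq_zero fun i _ => Finset.sum_eq_zero fun r _ => ?_
  have h : s ≠ s + oneUser i r := fun h => oneUser_ne_zero i r (by simpa using h)
  simp [h]

theorem exists_joinProb_ne_zero (π : AssociationPolicy B) (s : NetworkState B) :
    ∃ i r, N.joinProb π s i r ≠ 0 := by
  obtain ⟨k, hk⟩ : ∃ k, N.p k ≠ 0 := by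
    by_contra! h
    simpa [h] using N.sum_p
  obtain ⟨i, hi⟩ := (π s (N.rateVector k)).support_nonempty
  obtain ⟨r, hr⟩ : ∃ r, N.rateVector k i = N.dataRate r := by
    unfold rateVector; split_ifs
    exacts [⟨1, rfl⟩, ⟨0, rfl⟩]
  refine ⟨i, r, fun h => ?_⟩
  have h0 := (Finset.sum_eq_zero_iff.1 h) k (Finset.mem_univ k)
  rw [if_pos hr] at h0
  rcases mul_eq_zero.1 h0 with h1 | h1
  · exact hk (le_antisymm (ENNReal.ofReal_eq_zero.1 h1) (N.p_nonneg k))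
  · exact ((PMF.mem_support_iff _ _).1 hi) h1

theorem exit_ne_zero (π : AssociationPolicy B) (s : NetworkState B) :
    ∑' s', N.transitionRate π s s' ≠ 0 := by
  obtain ⟨i, r, h⟩ := N.exists_joinProb_ne_zero π s
  intro h0
  have h1 := ENNReal.tsum_eq_zero.1 h0 (s + oneUser i r)
  have h2 := (Finset.sum_eq_zero_iff.1 ((Finset.sum_eq_zero_iff.1 h1) i (Finset.mem_univ i))) r
    (Finset.mem_univ r)
  rw [if_pos rfl] at h2
  rcases mul_eq_zero.1 (add_eq_zero.1 h2).1 with h3 | h3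
  · exact absurd (ENNReal.ofReal_eq_zero.1 h3) (not_le.2 N.lam_pos)
  · exact h h3

theorem joinProb_ne_top (π : AssociationPolicy B) (s : NetworkState B) (i : Fin B) (r : Fin 2) :
    N.joinProb π s i r ≠ ∞ := by
  refine ENNReal.sum_ne_top.2 fun k _ => ENNReal.mul_ne_top ENNReal.ofReal_ne_top ?_
  split_ifs
  exacts [PMF.apply_ne_top _ _, ENNReal.zero_ne_top]

theorem exit_ne_top (π : AssociationPolicy B) (s : NetworkState B) :
    ∑' s', N.transitionRate π s s' ≠ ∞ := by
  have hsub : ∀ (i : Fin B) (r : Fin 2) (s' : NetworkState B),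
      s = s' + oneUser i r → s' = s - oneUser i r := by
    rintro i r s' rfl
    simp
  have hle : ∀ s', N.transitionRate π s s' ≤
      ∑ i, ∑ r, ((if s' = s + oneUser i r then N.arrivalRate π s i r else 0) +
        (if s' = s - oneUser i r then N.departureRate s i r else 0)) := by
    intro s'
    refine Finset.sum_le_sum fun i _ => Finset.sum_le_sum fun r _ => add_le_add le_rfl ?_
    by_cases h : s = s' + oneUser i r
    · rw [if_pos h, if_pos (hsub i r s' h)]
    · rw [if_neg h]; exact bot_le
  refine ne_top_of_le_ne_top ?_ (ENNReal.tsum_le_tsum hle)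
  rw [Summable.tsum_finsetSum fun _ _ => ENNReal.summable]
  refine ENNReal.sum_ne_top.2 fun i _ => ?_
  rw [Summable.tsum_finsetSum fun _ _ => ENNReal.summable]
  refine ENNReal.sum_ne_top.2 fun r _ => ?_
  rw [ENNReal.tsum_add, tsum_ite_eq, tsum_ite_eq]
  exact ENNReal.add_ne_top.2
    ⟨ENNReal.mul_ne_top ENNReal.ofReal_ne_top (N.joinProb_ne_top π s i r), ENNReal.ofReal_ne_top⟩

/-- The continuous-time Markov chain induced by an association policy. -/
noncomputable def ctmc (π : AssociationPolicy B) : TransitionRates (NetworkState B) where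
  rate := N.transitionRate π
  rate_self := N.transitionRate_self π
  exit_ne_zero := N.exit_ne_zero π
  exit_ne_top := N.exit_ne_top π

/-- The system is stable under a policy if the induced chain, for a network that is initially empty,
is positive recurrent. -/
def IsStable (π : AssociationPolicy B) : Prop :=
  (N.ctmc π).IsPositiveRecurrentFrom 0

end Network

/-!
Under the SNR based policy a user in the cell of BS `i` always joins BS `i`, at the high rate
(`Network.joinProb_snrPolicy`). So, on the states reached from the empty one, the BSs form
independent M/M/`m i` queues with arrival rates `λ p i` and service rate `μ c₂` per server, and the
theorem says that the chain is stable exactly when each of these queues is subcritical.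

Both directions look at the embedded chain up to its first return to a state `s`, through the taboo
probabilities `TransitionRates.tabooMass s n y` of being at `y` after `n` transitions without having
re-entered `s`. The mean holding times weighted with them add up to the expected time spent before
the return (`TransitionRates.lintegral_tsum_holding`), and their total mass is the probability that
the return takes more than `n` transitions (`TransitionRates.pathLaw_avoids`).

If all queues are subcritical, the product `Network.productWeight` of the stationary measures of the
queues is summable and satisfies detailed balance. A measure that is subinvariant for the embedded
chain dominates the expected numbers of visits before the return
(`TransitionRates.tsum_tabooMass_le`), so that the expected duration and the expected number of
transitions of an excursion from any state of positive mass are finite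
(`TransitionRates.positiveRecurrent_of_subinvariant`); reachable states have positive mass.

If the queue of BS `i` is critical or supercritical, the number of users that BS `i` serves at the
high rate has nonnegative drift in every state. Hence its mean over the excursions from the empty
state that last more than `n` transitions does not decrease with `n`. As the number is at most `n`,
such excursions have probability at least of order `1 / n`, and the harmonic series makes the
expected length of an excursion infinite (`TransitionRates.not_positiveRecurrent_of_drift`). As the
exit rates are bounded, its expected duration is infinite too.
-/

/-! ### The exponential distribution -/

theorem lintegral_ofReal_expMeasure {r : ℝ} (hr : 0 < r) :
    ∫⁻ t, ENNReal.ofReal t ∂expMeasure r = (ENNReal.ofReal r)⁻¹ := by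
  have hpdf : Measurable (exponentialPDF r) :=
    (measurable_exponentialPDFReal r).ennreal_ofReal
  have h1 : ∫⁻ t, ENNReal.ofReal t ∂expMeasure r
      = ∫⁻ t, exponentialPDF r t * ENNReal.ofReal t := by
    change ∫⁻ t, ENNReal.ofReal t ∂(volume.withDensity (exponentialPDF r)) = _
    rw [lintegral_withDensity_eq_lintegral_mul _ hpdf (by fun_prop)]
    rfl
  have h2 : ∀ t, exponentialPDF r t * ENNReal.ofReal t =
      (Set.Ioi (0 : ℝ)).indicator
        (fun t => ENNReal.ofReal (r * (t ^ ((2 : ℝ) - 1) * Real.exp (-(r * t))))) t := by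
    intro t
    by_cases ht : 0 < t
    · rw [Set.indicator_of_mem (Set.mem_Ioi.2 ht), exponentialPDF_of_nonneg ht.le,
        ← ENNReal.ofReal_mul (by positivity)]
      norm_num
      ring_nf
    · rw [Set.indicator_of_notMem (by simpa using ht),
        ENNReal.ofReal_of_nonpos (not_lt.1 ht), mul_zero]
  have h3 := Real.integral_rpow_mul_exp_neg_mul_Ioi (a := 2) (r := r) (by norm_num) hr
  have h4 : IntegrableOn (fun t : ℝ => r * (t ^ ((2 : ℝ) - 1) * Real.exp (-(r * t))))
      (Set.Ioi 0) := by
    refine Integrable.const_mul ?_ r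
    -- otherwise the integral, evaluated in `h3`, would be zero
    by_contra h
    rw [integral_undef h] at h3
    have : (0 : ℝ) < (1 / r) ^ (2 : ℝ) * Real.Gamma 2 :=
      mul_pos (by positivity) (Real.Gamma_pos_of_pos (by norm_num))
    exact this.ne h3
  rw [h1, lintegral_congr h2, lintegral_indicator measurableSet_Ioi,
    ← ofReal_integral_eq_lintegral_ofReal h4, integral_const_mul, h3,
    ← ENNReal.ofReal_inv_of_pos hr]
  · congr 1
    rw [Real.Gamma_two]
    have : (1 / r) ^ (2 : ℝ) = (1 / r) ^ 2 := by exact_mod_cast Real.rpow_natCast (1 / r) 2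
    rw [this]
    field_simp
  · filter_upwards [ae_restrict_mem measurableSet_Ioi] with t ht
    have : (0 : ℝ) < t := ht
    positivity

namespace TransitionRates

variable {S : Type*} (Q : TransitionRates S)

theorem ofReal_exitRate (x : S) : ENNReal.ofReal (Q.exitRate x) = ∑' y, Q.rate x y :=
  ENNReal.ofReal_toReal (Q.exit_ne_top x)

theorem embedded_apply (x y : S) : Q.embedded x y = Q.rate x y * (∑' z, Q.rate x z)⁻¹ :=
  PMF.normalize_apply _ _ _

/-! ### Excursions of a continuous-time Markov chain from a state -/

/-- The paths whose embedded chain does not enter `s` in the transitions `1, …, n`. -/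
def avoids (s : S) (n : ℕ) : Set (ℕ → S × ℝ) :=
  {ω | ∀ k, 1 ≤ k → k ≤ n → (ω k).1 ≠ s}

/-- The taboo probability `tabooMass s n y` that the embedded chain started at `s` is at `y` after
`n` transitions and has not re-entered `s` by then. -/
noncomputable def tabooMass (s : S) : ℕ → S → ℝ≥0∞
  | 0 => Set.indicator {s} 1
  | n + 1 => Set.indicator {s}ᶜ fun y => ∑' x, tabooMass s n x * Q.embedded x y

theorem avoids_succ_indicator (s : S) (n : ℕ) (ω : ℕ → S × ℝ) :
    (avoids s (n + 1)).indicator (1 : (ℕ → S × ℝ) → ℝ≥0∞) ω =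
      (avoids s n).indicator 1 ω * Set.indicator {s}ᶜ 1 (ω (n + 1)).1 := by
  have h : ω ∈ avoids s (n + 1) ↔ ω ∈ avoids s n ∧ (ω (n + 1)).1 ∈ ({s}ᶜ : Set S) := by
    refine ⟨fun h => ⟨fun k h1 h2 => h k h1 (by omega), h _ (by omega) le_rfl⟩, ?_⟩
    rintro ⟨h, h'⟩ k h1 h2
    rcases Nat.le_succ_iff.1 h2 with h2 | rfl
    exacts [h k h1 h2, h']
  by_cases h1 : ω ∈ avoids s n <;> by_cases h2 : (ω (n + 1)).1 ∈ ({s}ᶜ : Set S) <;>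
    simp only [Set.indicator, h, h1, h2, and_self, and_false, false_and, if_true, if_false,
      Pi.one_apply, mul_one, mul_zero]

theorem measurableSet_avoids [MeasurableSpace S] [MeasurableSingletonClass S] (s : S) (n : ℕ) :
    MeasurableSet (avoids s n) := by
  have : avoids s n = ⋂ k, ⋂ (_ : 1 ≤ k), ⋂ (_ : k ≤ n), {ω : ℕ → S × ℝ | (ω k).1 ≠ s} := by
    ext ω; simp [avoids]
  rw [this]
  refine .iInter fun k => .iInter fun _ => .iInter fun _ => ?_
  have h : Measurable fun ω : ℕ → S × ℝ => (ω k).1 := by fun_prop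
  exact (h (measurableSet_singleton s)).compl

/-- Only an inequality: on a path that never returns the left-hand side is the explosion time, which
may be finite, while the return time is infinite. -/
theorem tsum_holding_le_returnTime (s : S) (ω : ℕ → S × ℝ) :
    ∑' n, (avoids s n).indicator 1 ω * ENNReal.ofReal (ω n).2 ≤ returnTime s ω := by
  refine le_iInf₂ fun n hn => ?_
  rw [tsum_eq_sum (s := Finset.range n)]
  · refine Finset.sum_le_sum fun k _ => ?_
    by_cases h : ω ∈ avoids s k <;> simp [h]
  · intro k hk
    rw [Set.indicator_of_notMem, zero_mul]
    exact fun h => h n hn.1 (by simpa using hk) hn.2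

theorem returnTime_le_tsum_holding {s : S} {ω : ℕ → S × ℝ} (h : ∃ n, ω ∉ avoids s n) :
    returnTime s ω ≤ ∑' n, (avoids s n).indicator 1 ω * ENNReal.ofReal (ω n).2 := by
  classical
  have hex : ∃ n, 1 ≤ n ∧ (ω n).1 = s := by
    obtain ⟨n, hn⟩ := h
    simp only [avoids, Set.mem_ofPred_eq, not_forall, not_not] at hn
    obtain ⟨k, h1, -, h2⟩ := hn
    exact ⟨k, h1, h2⟩
  refine (iInf₂_le (Nat.find hex) (Nat.find_spec hex)).trans ?_
  refine le_trans (Finset.sum_le_sum fun k hk => ?_) (ENNReal.sum_le_tsum _)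
  rw [Set.indicator_of_mem, Pi.one_apply, one_mul]
  intro j h1 h2 h3
  exact Nat.find_min hex (lt_of_le_of_lt h2 (Finset.mem_range.1 hk)) ⟨h1, h3⟩

/-- A subinvariant measure of the embedded chain with mass at least one at `s` dominates the
expected numbers of visits between two consecutive visits to `s`. -/
theorem tsum_tabooMass_le {s : S} {ν : S → ℝ≥0∞} (hs : 1 ≤ ν s)
    (hν : ∀ y, ∑' x, ν x * Q.embedded x y ≤ ν y) (y : S) :
    ∑' n, Q.tabooMass s n y ≤ ν y := by
  have key : ∀ n y, ∑ k ∈ Finset.range n, Q.tabooMass s k y ≤ ν y := by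
    intro n
    induction n with
    | zero => simp
    | succ n ih =>
      intro y
      rw [Finset.sum_range_succ']
      by_cases hy : y = s
      · subst hy
        simpa [tabooMass] using hs
      · have h : ∀ k, Q.tabooMass s (k + 1) y = ∑' x, Q.tabooMass s k x * Q.embedded x y :=
          fun k => Set.indicator_of_mem (by simpa using hy) _
        have h0 : Q.tabooMass s 0 y = 0 := Set.indicator_of_notMem (by simpa using hy) _
        simp only [h, h0, add_zero]
        rw [← Summable.tsum_finsetSum fun _ _ => ENNReal.summable]
        refine le_trans (ENNReal.tsum_le_tsum fun x => ?_) (hν y)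
        rw [← Finset.sum_mul]
        gcongr
        exact ih x
  rw [ENNReal.tsum_eq_iSup_nat]
  exact iSup_le fun n => key n y

/-! ### The law of an excursion -/

variable [MeasurableSpace S] [Countable S] [MeasurableSingletonClass S]

theorem lintegral_jumpKernel (x : S) (f : S → ℝ≥0∞) :
    ∫⁻ y, f y ∂Q.jumpKernel x = ∑' y, Q.embedded x y * f y := by
  rw [lintegral_countable']
  refine tsum_congr fun y => ?_
  rw [mul_comm]
  congr 1
  exact PMF.toMeasure_apply_singleton _ _ (measurableSet_singleton y)

theorem lintegral_stepKernel (z : S × ℝ) {g : S × ℝ → ℝ≥0∞} (hg : Measurable g) :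
    ∫⁻ w, g w ∂Q.stepKernel z =
      ∑' y, Q.embedded z.1 y * ∫⁻ t, g (y, t) ∂expMeasure (Q.exitRate y) := by
  rw [stepKernel, Kernel.lintegral_comap, Kernel.lintegral_comp _ _ _ hg, lintegral_jumpKernel]
  refine tsum_congr fun y => ?_
  rw [Kernel.lintegral_id_prod hg]
  rfl

theorem pathLaw_map_zero (s : S) :
    (Q.pathLaw s).map (fun ω => ω 0) = (Measure.dirac s).prod (Q.holdingKernel s) := by
  have hm : Measurable fun x : (i : Finset.Iic 0) → S × ℝ => x ⟨0, Finset.mem_Iic.2 le_rfl⟩ :=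
    measurable_pi_apply _
  have h : (fun ω : ℕ → S × ℝ => ω 0) =
      (fun x : (i : Finset.Iic 0) → S × ℝ => x ⟨0, Finset.mem_Iic.2 le_rfl⟩) ∘
        Preorder.frestrictLe (π := fun _ : ℕ => S × ℝ) 0 := rfl
  rw [h, ← Measure.map_map hm (by fun_prop), pathLaw, Kernel.trajMeasure,
    Measure.map_comp _ _ (by fun_prop), Kernel.traj_map_frestrictLe, Kernel.partialTraj_self,
    Measure.id_comp, Measure.map_map hm (MeasurableEquiv.measurable _)]
  exact Measure.map_id

instance (s : S) : IsProbabilityMeasure (Q.pathLaw s) := by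
  unfold pathLaw; infer_instance

theorem lintegral_pathLaw_zero (s : S) {g : S × ℝ → ℝ≥0∞} (hg : Measurable g) :
    ∫⁻ ω, g (ω 0) ∂Q.pathLaw s = ∫⁻ t, g (s, t) ∂expMeasure (Q.exitRate s) := by
  rw [← lintegral_map hg (measurable_pi_apply 0), pathLaw_map_zero,
    lintegral_prod _ hg.aemeasurable, lintegral_dirac]
  rfl

/-- The Markov property: given the history up to time `n`, the next state is chosen by the embedded
chain from the present one, and its holding time is exponential. -/
theorem lintegral_pathLaw_succ (s : S) (n : ℕ)
    {G : ((i : Finset.Iic n) → S × ℝ) → ℝ≥0∞} (hG : Measurable G)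
    {g : S × ℝ → ℝ≥0∞} (hg : Measurable g) :
    ∫⁻ ω, G (Preorder.frestrictLe (π := fun _ : ℕ => S × ℝ) n ω) * g (ω (n + 1)) ∂Q.pathLaw s =
      ∫⁻ ω, G (Preorder.frestrictLe (π := fun _ : ℕ => S × ℝ) n ω) *
        (∑' y, Q.embedded (ω n).1 y * ∫⁻ t, g (y, t) ∂expMeasure (Q.exitRate y))
        ∂Q.pathLaw s := by
  have h := Kernel.map_frestrictLe_trajMeasure_compProd_eq_map_trajMeasure
    (X := fun _ : ℕ => S × ℝ) (μ₀ := (Measure.dirac s).prod (Q.holdingKernel s))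
    (κ := Q.historyKernel) (a := n)
  have hF : Measurable fun x : ((i : Finset.Iic n) → S × ℝ) × (S × ℝ) => G x.1 * g x.2 := by
    fun_prop
  have h1 := congrArg (fun ν => ∫⁻ x, G x.1 * g x.2 ∂ν) h
  rw [Measure.lintegral_compProd hF, lintegral_map hF (by fun_prop)] at h1
  rw [pathLaw]
  refine h1.symm.trans ?_
  rw [lintegral_map hF.lintegral_kernel_prod_right' (by fun_prop)]
  refine lintegral_congr fun ω => ?_
  simp only
  rw [lintegral_const_mul _ (by fun_prop)]
  congr 1
  rw [historyKernel, Kernel.lintegral_comap, lintegral_stepKernel _ _ hg]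
  rfl

/-- On the event that `s` has not been re-entered, the state after `n` transitions is distributed
according to the taboo probabilities, and its holding time is exponential given that state. -/
theorem lintegral_avoids (s : S) (n : ℕ) {g : S × ℝ → ℝ≥0∞} (hg : Measurable g) :
    ∫⁻ ω, (avoids s n).indicator 1 ω * g (ω n) ∂Q.pathLaw s =
      ∑' y, Q.tabooMass s n y * ∫⁻ t, g (y, t) ∂expMeasure (Q.exitRate y) := by
  classical
  induction n generalizing g with
  | zero =>
    have h : ∀ ω : ℕ → S × ℝ, (avoids s 0).indicator (1 : (ℕ → S × ℝ) → ℝ≥0∞) ω = 1 := fun ω =>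
      Set.indicator_of_mem (fun k h1 h2 => by omega) _
    simp only [h, one_mul]
    rw [lintegral_pathLaw_zero _ _ hg, tsum_eq_single s]
    · simp [tabooMass]
    · intro y hy
      simp [tabooMass, hy]
  | succ n ih =>
    have hi : Measurable (Set.indicator ({s}ᶜ : Set S) (1 : S → ℝ≥0∞)) :=
      measurable_one.indicator (measurableSet_singleton s).compl
    have hg' : Measurable fun z : S × ℝ => Set.indicator ({s}ᶜ : Set S) 1 z.1 * g z :=
      (hi.comp measurable_fst).mul hg
    -- the event of not having re-entered `s`, as a function of the history up to time `n`
    let A : Set ((i : Finset.Iic n) → S × ℝ) :=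
      {h | ∀ k (hk : k ≤ n), 1 ≤ k → (h ⟨k, Finset.mem_Iic.2 hk⟩).1 ≠ s}
    have hA : MeasurableSet A := by
      have : A = ⋂ k, ⋂ (hk : k ≤ n), ⋂ (_ : 1 ≤ k),
          {h : (i : Finset.Iic n) → S × ℝ | (h ⟨k, Finset.mem_Iic.2 hk⟩).1 ≠ s} := by
        ext ω; simp [A]
      rw [this]
      refine .iInter fun k => .iInter fun hk => .iInter fun _ => ?_
      have h : Measurable fun ω : (i : Finset.Iic n) → S × ℝ =>
          (ω ⟨k, Finset.mem_Iic.2 hk⟩).1 := by fun_prop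
      exact (h (measurableSet_singleton s)).compl
    have hG : ∀ ω : ℕ → S × ℝ, (avoids s n).indicator (1 : (ℕ → S × ℝ) → ℝ≥0∞) ω =
        A.indicator 1 (Preorder.frestrictLe (π := fun _ : ℕ => S × ℝ) n ω) := by
      intro ω
      have : ω ∈ avoids s n ↔ Preorder.frestrictLe (π := fun _ : ℕ => S × ℝ) n ω ∈ A :=
        ⟨fun h k hk h1 => h k h1 hk, fun h k h1 hk => h k hk h1⟩
      simp only [Set.indicator, this, Pi.one_apply]
    have hstep := Q.lintegral_pathLaw_succ s n (measurable_one.indicator hA) hg'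
    simp only [avoids_succ_indicator, mul_assoc]
    simp only [← hG] at hstep
    rw [hstep, ih (g := fun z => ∑' y, Q.embedded z.1 y *
      ∫⁻ t, Set.indicator ({s}ᶜ : Set S) 1 y * g (y, t) ∂expMeasure (Q.exitRate y))]
    · have hprob : ∀ y, IsProbabilityMeasure (expMeasure (Q.exitRate y)) := fun y =>
        isProbabilityMeasure_expMeasure (Q.exitRate_pos y)
      simp only [lintegral_const, measure_univ, mul_one, ← ENNReal.tsum_mul_left]
      rw [ENNReal.tsum_comm]
      refine tsum_congr fun y => ?_
      by_cases hy : y = s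
      · simp [tabooMass, hy]
      · simp only [tabooMass, Set.indicator, Set.mem_compl_iff, Set.mem_singleton_iff, hy,
          not_false_eq_true, if_true, Pi.one_apply, one_mul, ← ENNReal.tsum_mul_right, mul_assoc]
    · have h : Measurable fun x : S => ∑' y, Q.embedded x y *
          ∫⁻ t, Set.indicator ({s}ᶜ : Set S) 1 y * g (y, t) ∂expMeasure (Q.exitRate y) :=
        measurable_of_countable _
      exact h.comp measurable_fst

theorem pathLaw_avoids (s : S) (n : ℕ) :
    Q.pathLaw s (avoids s n) = ∑' y, Q.tabooMass s n y := by
  have h := Q.lintegral_avoids s n (g := 1) measurable_one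
  have hprob : ∀ y, IsProbabilityMeasure (expMeasure (Q.exitRate y)) := fun y =>
    isProbabilityMeasure_expMeasure (Q.exitRate_pos y)
  simpa [lintegral_indicator_one (measurableSet_avoids s n)] using h

/-- The expected total holding time of the visits that precede the first return. -/
theorem lintegral_tsum_holding (s : S) :
    ∫⁻ ω, ∑' n, (avoids s n).indicator 1 ω * ENNReal.ofReal (ω n).2 ∂Q.pathLaw s =
      ∑' n, ∑' y, Q.tabooMass s n y * (∑' z, Q.rate y z)⁻¹ := by
  rw [lintegral_tsum]
  · refine tsum_congr fun n => ?_
    rw [Q.lintegral_avoids s n (g := fun z => ENNReal.ofReal z.2) (by fun_prop)]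
    refine tsum_congr fun y => ?_
    rw [lintegral_ofReal_expMeasure (Q.exitRate_pos y), ofReal_exitRate]
  · intro n
    exact ((measurable_one.indicator (measurableSet_avoids s n)).mul (by fun_prop)).aemeasurable

/-! ### Criteria for positive recurrence -/

/-- A chain with a summable measure that satisfies the balance inequalities, and that also gives a
finite total jump rate, is positive recurrent at each state of positive mass: the expected return
time to `s` is at most `∑ π / (π s · exit rate of s)`, and the expected number of transitions before
the return is finite, so that the return is almost sure. -/
theorem positiveRecurrent_of_subinvariant {π : S → ℝ≥0∞}
    (hπ : ∀ y, ∑' x, π x * Q.rate x y ≤ π y * ∑' z, Q.rate y z)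
    (hsum : ∑' x, π x ≠ ∞) (hflow : ∑' x, π x * ∑' z, Q.rate x z ≠ ∞) {s : S} (hs : π s ≠ 0) :
    Q.PositiveRecurrent s := by
  set q : S → ℝ≥0∞ := fun x => ∑' z, Q.rate x z with hq
  have hq0 : ∀ x, q x ≠ 0 := Q.exit_ne_zero
  have hqt : ∀ x, q x ≠ ∞ := Q.exit_ne_top
  -- normalise so that the subinvariant measure `ν` of the embedded chain has mass one at `s`
  set c : ℝ≥0∞ := (π s * q s)⁻¹ with hc
  have hπs : π s ≠ ∞ := ENNReal.ne_top_of_tsum_ne_top hsum s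
  have hct : c ≠ ∞ := ENNReal.inv_ne_top.2 (mul_ne_zero hs (hq0 s))
  set ν : S → ℝ≥0∞ := fun x => c * (π x * q x) with hν
  have hν1 : 1 ≤ ν s :=
    (ENNReal.inv_mul_cancel (mul_ne_zero hs (hq0 s)) (ENNReal.mul_ne_top hπs (hqt s))).ge
  have hνinv : ∀ y, ∑' x, ν x * Q.embedded x y ≤ ν y := by
    intro y
    have : ∀ x, ν x * Q.embedded x y = c * (π x * Q.rate x y) := by
      intro x
      rw [embedded_apply]
      calc c * (π x * q x) * (Q.rate x y * (q x)⁻¹)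
          = c * (π x * Q.rate x y) * (q x * (q x)⁻¹) := by ring
        _ = _ := by rw [ENNReal.mul_inv_cancel (hq0 x) (hqt x), mul_one]
    simp only [this, ENNReal.tsum_mul_left]
    exact mul_le_mul_right (hπ y) c
  have hvisits := Q.tsum_tabooMass_le hν1 hνinv
  have htime : ∑' n, ∑' y, Q.tabooMass s n y * (q y)⁻¹ ≠ ∞ := by
    rw [ENNReal.tsum_comm]
    refine ne_top_of_le_ne_top (ENNReal.mul_ne_top hct hsum) ?_
    rw [← ENNReal.tsum_mul_left]
    refine ENNReal.tsum_le_tsum fun y => ?_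
    rw [ENNReal.tsum_mul_right]
    calc (∑' n, Q.tabooMass s n y) * (q y)⁻¹ ≤ c * (π y * q y) * (q y)⁻¹ := by
          gcongr; exact hvisits y
      _ = c * π y * (q y * (q y)⁻¹) := by ring
      _ = c * π y := by rw [ENNReal.mul_inv_cancel (hq0 y) (hqt y), mul_one]
  have hjumps : ∑' n, Q.pathLaw s (avoids s n) ≠ ∞ := by
    simp only [pathLaw_avoids]
    rw [ENNReal.tsum_comm]
    refine ne_top_of_le_ne_top (ENNReal.mul_ne_top hct hflow) ?_
    rw [← ENNReal.tsum_mul_left]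
    exact ENNReal.tsum_le_tsum hvisits
  have hreturn : ∀ᵐ ω ∂Q.pathLaw s, ∃ n, ω ∉ avoids s n := by
    -- Borel–Cantelli
    filter_upwards [ae_eventually_notMem hjumps] with ω hω
    exact hω.exists
  refine lt_of_le_of_lt (lintegral_mono_ae ?_)
    ((Q.lintegral_tsum_holding s).trans_lt htime.lt_top)
  filter_upwards [hreturn] with ω hω using returnTime_le_tsum_holding hω

/-- A chain with bounded exit rates is not positive recurrent at `s` if some function vanishes at
`s`, grows by at most one per transition, has nonnegative drift and has positive mean after one
transition. Before the return to `s` its mean stays bounded below although it is at most `n` after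
`n` transitions, so the probability of not having returned is at least of order `1 / n`, and the
expected number of transitions before the return is infinite. -/
theorem not_positiveRecurrent_of_drift {s : S} {f : S → ℕ} (hs : f s = 0)
    (hstep : ∀ x y, Q.rate x y ≠ 0 → f y ≤ f x + 1)
    (hdrift : ∀ x, (∑' y, Q.rate x y) * f x ≤ ∑' y, Q.rate x y * f y)
    (hpos : ∑' y, Q.rate s y * f y ≠ 0)
    {C : ℝ≥0∞} (hC : C ≠ ∞) (hbound : ∀ x, ∑' y, Q.rate x y ≤ C) :
    ¬ Q.PositiveRecurrent s := by
  intro hrec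
  set γ := Q.tabooMass s with hγ
  -- as `f s = 0`, nothing is lost at the transitions into `s`
  have hmean : ∀ n, ∑' y, γ (n + 1) y * f y =
      ∑' x, γ n x * ((∑' z, Q.rate x z)⁻¹ * ∑' y, Q.rate x y * f y) := by
    intro n
    have : ∀ y, γ (n + 1) y * f y =
        ∑' x, γ n x * ((∑' z, Q.rate x z)⁻¹ * (Q.rate x y * f y)) := by
      intro y
      by_cases hy : y = s
      · simp [hy, hs]
      · rw [hγ, tabooMass, Set.indicator_of_mem (by simpa using hy), ← ENNReal.tsum_mul_right]
        refine tsum_congr fun x => ?_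
        rw [embedded_apply]
        ring
    simp only [this, ← ENNReal.tsum_mul_left]
    exact ENNReal.tsum_comm
  set a : ℝ≥0∞ := ∑' y, γ 1 y * f y with ha
  have ha0 : a ≠ 0 := by
    rw [ha, hmean 0, tsum_eq_single s]
    · simp only [hγ, tabooMass, Set.indicator_of_mem (Set.mem_singleton s), Pi.one_apply, one_mul]
      exact mul_ne_zero (ENNReal.inv_ne_zero.2 (Q.exit_ne_top s)) hpos
    · intro y hy
      simp [hγ, tabooMass, hy]
  have hmono : ∀ n, a ≤ ∑' y, γ (n + 1) y * f y := by
    intro n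
    induction n with
    | zero => exact le_rfl
    | succ n ih =>
      refine ih.trans ?_
      rw [hmean (n + 1)]
      refine ENNReal.tsum_le_tsum fun x => ?_
      gcongr
      rw [mul_comm, ← div_eq_mul_inv,
        ENNReal.le_div_iff_mul_le (Or.inl (Q.exit_ne_zero x)) (Or.inl (Q.exit_ne_top x)), mul_comm]
      exact hdrift x
  have hsupp : ∀ n y, γ n y ≠ 0 → f y ≤ n := by
    intro n
    induction n with
    | zero =>
      intro y hy
      have : y = s := by
        by_contra h
        exact hy (Set.indicator_of_notMem (by simpa using h) _)
      simp [this, hs]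
    | succ n ih =>
      intro y hy
      have hne : ∑' x, γ n x * Q.embedded x y ≠ 0 := fun h => hy <| by
        rw [hγ, tabooMass]
        by_cases hys : y = s
        · exact Set.indicator_of_notMem (by simpa using hys) _
        · rwa [Set.indicator_of_mem (by simpa using hys)]
      obtain ⟨x, hx⟩ : ∃ x, γ n x * Q.embedded x y ≠ 0 := by
        by_contra! h
        exact hne (ENNReal.tsum_eq_zero.2 h)
      have h1 := ih x (left_ne_zero_of_mul hx)
      have h2 := hstep x y fun h => hx (by rw [embedded_apply, h, zero_mul, mul_zero])
      omega
  have htail : ∀ n : ℕ, a * ((n + 1 : ℕ) : ℝ≥0∞)⁻¹ ≤ ∑' y, γ (n + 1) y := by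
    intro n
    rw [← div_eq_mul_inv]
    refine ENNReal.div_le_of_le_mul ((hmono n).trans ?_)
    rw [← ENNReal.tsum_mul_right]
    refine ENNReal.tsum_le_tsum fun y => ?_
    by_cases hy : γ (n + 1) y = 0
    · simp [hy]
    · gcongr
      exact hsupp _ _ hy
  have htime : ∑' n, ∑' y, γ n y * (∑' z, Q.rate y z)⁻¹ ≠ ∞ := by
    rw [← Q.lintegral_tsum_holding s]
    exact (lt_of_le_of_lt (lintegral_mono (tsum_holding_le_returnTime s)) hrec).ne
  have hharm : ∑' n : ℕ, ((n + 1 : ℕ) : ℝ≥0∞)⁻¹ = ∞ := by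
    by_contra h
    have h1 := ENNReal.summable_toReal h
    simp only [ENNReal.toReal_inv, ENNReal.toReal_natCast] at h1
    exact Real.not_summable_natCast_inv ((summable_nat_add_iff 1).1 h1)
  have hCinv : C⁻¹ ≠ 0 := ENNReal.inv_ne_zero.2 hC
  refine htime (top_unique ?_)
  calc (∞ : ℝ≥0∞) = ∑' n : ℕ, a * ((n + 1 : ℕ) : ℝ≥0∞)⁻¹ * C⁻¹ := by
        rw [ENNReal.tsum_mul_right, ENNReal.tsum_mul_left, hharm, ENNReal.mul_top ha0,
          ENNReal.top_mul hCinv]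
    _ ≤ ∑' n : ℕ, (∑' y, γ (n + 1) y) * C⁻¹ := ENNReal.tsum_le_tsum fun n => by
        gcongr; exact htail n
    _ ≤ ∑' n : ℕ, ∑' y, γ (n + 1) y * (∑' z, Q.rate y z)⁻¹ := ENNReal.tsum_le_tsum fun n => by
        rw [← ENNReal.tsum_mul_right]
        refine ENNReal.tsum_le_tsum fun y => ?_
        gcongr
        exact hbound y
    _ ≤ _ := ENNReal.tsum_comp_le_tsum_of_injective (add_left_injective 1) _

end TransitionRates

/-! ### Transition rates under the SNR based policy -/

namespace Network

variable {B : ℕ} (N : Network B)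

theorem joinProb_snrPolicy [NeZero B] (s : NetworkState B) (i : Fin B) (r : Fin 2) :
    N.joinProb (snrPolicy B) s i r = if r = 1 then ENNReal.ofReal (N.p i) else 0 := by
  have hc := N.one_lt_c₂
  have hbest : ∀ k : Fin B,
      (Finset.univ.filter fun a => ∀ j, N.rateVector k j ≤ N.rateVector k a) = {k} := by
    -- the rate with BS `k` is `c₂`, and the other rates are `1 < c₂`
    intro k
    ext a
    simp only [Finset.mem_filter, Finset.mem_univ, true_and, Finset.mem_singleton]
    constructor
    · intro h
      by_contra hak
      have := h k
      simp only [rateVector, dataRate, hak, if_true, if_false, Matrix.cons_val_zero,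
        Matrix.cons_val_one] at this
      linarith
    · rintro rfl j
      simp only [rateVector, dataRate, Matrix.cons_val_zero, Matrix.cons_val_one, if_true]
      split_ifs <;> linarith
  have hpol : ∀ k : Fin B, snrPolicy B s (N.rateVector k) i = if i = k then 1 else 0 := by
    intro k
    simp only [snrPolicy, PMF.uniformOfFinset_apply, hbest, Finset.mem_singleton,
      Finset.card_singleton, Nat.cast_one, inv_one]
  simp only [joinProb, hpol]
  rw [Finset.sum_eq_single i]
  · fin_cases r
    · simp [rateVector, dataRate, hc.ne']
    · simp [rateVector]
  · intro k _ hk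
    simp [hk.symm]
  · simp

theorem departureRate_eq_zero {s : NetworkState B} {i : Fin B} {r : Fin 2} (h : s i r = 0) :
    N.departureRate s i r = 0 := by
  simp [departureRate, h]

/-- The departure rate is at most what `m i` servers yield at the high rate; the low rate is
smaller, and the servers are shared among all users of BS `i`. -/
theorem departureRate_le (s : NetworkState B) (i : Fin B) (r : Fin 2) :
    N.departureRate s i r ≤ ENNReal.ofReal (N.μ * (N.c₂ * N.m i)) := by
  refine ENNReal.ofReal_le_ofReal (mul_le_mul_of_nonneg_left ?_ N.μ_pos.le)
  have hc := N.one_lt_c₂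
  have hrate : 0 ≤ N.dataRate r ∧ N.dataRate r ≤ N.c₂ := by
    fin_cases r <;> simp [dataRate] <;> linarith
  have hshare : (s i r : ℝ) / (s i 0 + s i 1 : ℕ) ≤ 1 := by
    refine div_le_one_of_le₀ ?_ (Nat.cast_nonneg _)
    have : s i r ≤ s i 0 + s i 1 := by fin_cases r <;> simp
    exact_mod_cast this
  have hmin : ((min (N.m i) (s i 0 + s i 1) : ℕ) : ℝ) ≤ N.m i := by
    exact_mod_cast min_le_left _ _
  calc (s i r : ℝ) * N.throughput s i r
      = N.dataRate r * (min (N.m i) (s i 0 + s i 1) : ℕ) *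
          ((s i r : ℝ) / (s i 0 + s i 1 : ℕ)) := by
        unfold throughput; ring
    _ ≤ N.c₂ * N.m i * 1 := by
        gcongr
        exact hrate.2
    _ = _ := mul_one _

/-- The truncated subtraction in `s - oneUser i r` is harmless, since the departure rate vanishes if
`s i r = 0`. -/
theorem tsum_transitionRate_mul (π : AssociationPolicy B) (s : NetworkState B)
    (f : NetworkState B → ℝ≥0∞) :
    ∑' s', N.transitionRate π s s' * f s' =
      ∑ i, ∑ r, (N.arrivalRate π s i r * f (s + oneUser i r) +
        N.departureRate s i r * f (s - oneUser i r)) := by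
  have hdep : ∀ (i : Fin B) (r : Fin 2) (s' : NetworkState B),
      (if s = s' + oneUser i r then N.departureRate s i r else 0) =
        if s' = s - oneUser i r then N.departureRate s i r else 0 := by
    intro i r s'
    by_cases h0 : s i r = 0
    · simp [N.departureRate_eq_zero h0]
    · refine if_congr ⟨?_, ?_⟩ rfl rfl
      · rintro rfl
        simp
      · rintro rfl
        refine (tsub_add_cancel_of_le fun j t => ?_).symm
        by_cases hj : j = i
        · subst hj
          by_cases ht : t = r
          · subst ht
            simpa [oneUser] using Nat.one_le_iff_ne_zero.2 h0
          · simp [oneUser, ht]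
        · simp [oneUser, hj]
  simp only [transitionRate, hdep, Finset.sum_mul, add_mul, ite_mul, zero_mul]
  rw [Summable.tsum_finsetSum fun _ _ => ENNReal.summable]
  refine Finset.sum_congr rfl fun i _ => ?_
  rw [Summable.tsum_finsetSum fun _ _ => ENNReal.summable]
  refine Finset.sum_congr rfl fun r _ => ?_
  have h : ∀ (a : NetworkState B) (c : ℝ≥0∞),
      ∑' s', (if s' = a then c * f s' else 0) = c * f a := fun a c => by
    rw [tsum_eq_single a fun b hb => if_neg hb, if_pos rfl]
  rw [ENNReal.tsum_add, h, h]

theorem exists_eq_add_of_transitionRate_ne_zero {π : AssociationPolicy B} {s s' : NetworkState B}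
    (h : N.transitionRate π s s' ≠ 0) :
    ∃ i r, s' = s + oneUser i r ∨ s = s' + oneUser i r := by
  by_contra! h'
  refine h (Finset.sum_eq_zero fun i _ => Finset.sum_eq_zero fun r _ => ?_)
  simp [h' i r]

/-- A bound for all exit rates under the SNR based policy: the arrival rates plus, for each BS and
each of the two data rates, the departure rate of a BS that is fully used at the high rate. -/
noncomputable def exitBound : ℝ≥0∞ :=
  ∑ i, ∑ r : Fin 2, (ENNReal.ofReal N.lam * (if r = 1 then ENNReal.ofReal (N.p i) else 0) +
    ENNReal.ofReal (N.μ * (N.c₂ * N.m i)))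

theorem exitBound_ne_top : N.exitBound ≠ ∞ := by
  refine ENNReal.sum_ne_top.2 fun i _ => ENNReal.sum_ne_top.2 fun r _ => ENNReal.add_ne_top.2
    ⟨ENNReal.mul_ne_top ENNReal.ofReal_ne_top ?_, ENNReal.ofReal_ne_top⟩
  split_ifs
  exacts [ENNReal.ofReal_ne_top, ENNReal.zero_ne_top]

theorem tsum_transitionRate_le [NeZero B] (s : NetworkState B) :
    ∑' s', N.transitionRate (snrPolicy B) s s' ≤ N.exitBound := by
  have h := N.tsum_transitionRate_mul (snrPolicy B) s fun _ => 1
  simp only [mul_one] at h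
  rw [h]
  refine Finset.sum_le_sum fun i _ => Finset.sum_le_sum fun r _ => ?_
  rw [arrivalRate, joinProb_snrPolicy]
  gcongr
  exact N.departureRate_le s i r

/-! ### Instability -/

/-- If the offered load of BS `i` is at least its capacity, then the empty state is not positive
recurrent: the number of users that BS `i` serves at the high rate has nonnegative drift. -/
theorem not_positiveRecurrent_zero [NeZero B] {i : Fin B}
    (h : N.μ * (N.c₂ * N.m i) ≤ N.lam * N.p i) :
    ¬ (N.ctmc (snrPolicy B)).PositiveRecurrent 0 := by
  have hm : (0 : ℝ) < N.m i := by exact_mod_cast N.one_le_m i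
  have hc : 0 < N.c₂ := zero_lt_one.trans N.one_lt_c₂
  have hload : 0 < N.lam * N.p i :=
    lt_of_lt_of_le (mul_pos N.μ_pos (mul_pos hc hm)) h
  have hA : ∀ s, N.arrivalRate (snrPolicy B) s i 1 = ENNReal.ofReal (N.lam * N.p i) := by
    intro s
    rw [arrivalRate, joinProb_snrPolicy, if_pos rfl, ENNReal.ofReal_mul N.lam_pos.le]
  have hother : ∀ j r, ¬ (j = i ∧ r = 1) → oneUser j r i 1 = 0 := by
    intro j r hjr
    by_cases hj : j = i
    · subst hj
      have : (1 : Fin 2) ≠ r := fun h => hjr ⟨rfl, h.symm⟩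
      simp [oneUser, this]
    · simp [oneUser, Ne.symm hj]
  have hself : oneUser i 1 i 1 = 1 := by simp [oneUser]
  refine TransitionRates.not_positiveRecurrent_of_drift (f := fun s => s i 1) _ rfl ?_ ?_ ?_
    N.exitBound_ne_top N.tsum_transitionRate_le
  · intro s s' hss
    have hone : ∀ j r, oneUser j r i 1 ≤ 1 := by
      intro j r
      by_cases hjr : j = i ∧ r = 1
      · rw [hjr.1, hjr.2, hself]
      · rw [hother j r hjr]; exact zero_le_one
    obtain ⟨j, r, rfl | rfl⟩ := N.exists_eq_add_of_transitionRate_ne_zero hss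
    · simpa using hone j r
    · simp only [Pi.add_apply]
      omega
  · intro s
    change (∑' s', N.transitionRate (snrPolicy B) s s') * (s i 1 : ℝ≥0∞) ≤
      ∑' s', N.transitionRate (snrPolicy B) s s' * (s' i 1 : ℝ≥0∞)
    rw [← ENNReal.tsum_mul_right, tsum_transitionRate_mul,
      N.tsum_transitionRate_mul (snrPolicy B) s fun s' => (s' i 1 : ℝ≥0∞)]
    refine Finset.sum_le_sum fun j _ => Finset.sum_le_sum fun r _ => ?_
    by_cases hjr : j = i ∧ r = 1
    · obtain ⟨rfl, rfl⟩ := hjr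
      have hD : N.departureRate s j 1 ≤ N.arrivalRate (snrPolicy B) s j 1 := by
        rw [hA]
        exact (N.departureRate_le s j 1).trans (ENNReal.ofReal_le_ofReal h)
      simp only [Pi.add_apply, Pi.sub_apply, hself]
      rcases hs : s j 1 with _ | n
      · simp
      · rw [Nat.add_sub_cancel]
        push_cast
        calc _ = N.arrivalRate (snrPolicy B) s j 1 * (n + 1) + N.departureRate s j 1 * n +
              N.departureRate s j 1 := by ring
          _ ≤ N.arrivalRate (snrPolicy B) s j 1 * (n + 1) + N.departureRate s j 1 * n +
              N.arrivalRate (snrPolicy B) s j 1 := by gcongr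
          _ = _ := by ring
    · simp only [Pi.add_apply, Pi.sub_apply, hother j r hjr, add_zero, tsub_zero, le_refl]
  · change ∑' s', N.transitionRate (snrPolicy B) 0 s' * (s' i 1 : ℝ≥0∞) ≠ 0
    rw [N.tsum_transitionRate_mul (snrPolicy B) 0 fun s' => (s' i 1 : ℝ≥0∞)]
    intro h0
    have h1 := (Finset.sum_eq_zero_iff.1 h0) i (Finset.mem_univ i)
    have h2 := (add_eq_zero.1 ((Finset.sum_eq_zero_iff.1 h1) 1 (Finset.mem_univ 1))).1
    rw [hA, zero_add, hself, Nat.cast_one, mul_one, ENNReal.ofReal_eq_zero] at h2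
    exact absurd h2 (not_le.2 hload)

/-! ### The product-form stationary measure -/

/-- The weight of `n` users in the stationary measure of the M/M/`m i` queue formed by BS `i`. -/
noncomputable def queueWeight (i : Fin B) (n : ℕ) : ℝ :=
  ∏ k ∈ Finset.range n, N.lam * N.p i / (N.μ * (N.c₂ * (min (N.m i) (k + 1) : ℕ)))

/-- The product-form stationary measure: independent M/M/`m i` queues, with no user served at the
low rate. -/
noncomputable def productWeight (s : NetworkState B) : ℝ≥0∞ :=
  ∏ i, if s i 0 = 0 then ENNReal.ofReal (N.queueWeight i (s i 1)) else 0

theorem serviceRate_pos (i : Fin B) (k : ℕ) :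
    0 < N.μ * (N.c₂ * (min (N.m i) (k + 1) : ℕ)) := by
  have hm := N.one_le_m i
  have : 0 < min (N.m i) (k + 1) := by omega
  have hc : 0 < N.c₂ := zero_lt_one.trans N.one_lt_c₂
  exact mul_pos N.μ_pos (mul_pos hc (by exact_mod_cast this))

theorem queueWeight_nonneg (i : Fin B) (n : ℕ) : 0 ≤ N.queueWeight i n :=
  Finset.prod_nonneg fun k _ =>
    div_nonneg (mul_nonneg N.lam_pos.le (N.p_nonneg i)) (N.serviceRate_pos i k).le

/-- Detailed balance between a state and the state with one more user. -/
theorem productWeight_mul_arrivalRate [NeZero B] (s : NetworkState B) (i : Fin B) (r : Fin 2) :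
    N.productWeight s * N.arrivalRate (snrPolicy B) s i r =
      N.productWeight (s + oneUser i r) * N.departureRate (s + oneUser i r) i r := by
  obtain rfl | rfl : r = 0 ∨ r = 1 := by fin_cases r <;> simp
  · have h : N.productWeight (s + oneUser i 0) = 0 :=
      Finset.prod_eq_zero (Finset.mem_univ i) (by simp [oneUser])
    rw [h, zero_mul, arrivalRate, joinProb_snrPolicy, if_neg (by decide), mul_zero, mul_zero]
  · have hne : ∀ j ∈ Finset.univ.erase i, (s + oneUser i 1) j = s j := by
      intro j hj
      simp [oneUser, Finset.ne_of_mem_erase hj]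
    have h0 : (s + oneUser i 1) i 0 = s i 0 := by simp [oneUser]
    have h1 : (s + oneUser i 1) i 1 = s i 1 + 1 := by simp [oneUser]
    have hprod : (∏ j ∈ Finset.univ.erase i, if (s + oneUser i 1) j 0 = 0 then
        ENNReal.ofReal (N.queueWeight j ((s + oneUser i 1) j 1)) else 0) =
        ∏ j ∈ Finset.univ.erase i,
          if s j 0 = 0 then ENNReal.ofReal (N.queueWeight j (s j 1)) else 0 :=
      Finset.prod_congr rfl fun j hj => by rw [hne j hj]
    rw [productWeight, productWeight, ← Finset.mul_prod_erase _ _ (Finset.mem_univ i),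
      ← Finset.mul_prod_erase Finset.univ (fun j => if (s + oneUser i 1) j 0 = 0 then
        ENNReal.ofReal (N.queueWeight j ((s + oneUser i 1) j 1)) else 0) (Finset.mem_univ i),
      hprod, mul_right_comm, mul_right_comm _ _ (N.departureRate _ _ _)]
    congr 1
    rw [h0, h1]
    by_cases hs : s i 0 = 0
    · rw [if_pos hs, if_pos hs, arrivalRate, joinProb_snrPolicy, if_pos rfl, departureRate,
        ← ENNReal.ofReal_mul N.lam_pos.le, ← ENNReal.ofReal_mul (N.queueWeight_nonneg _ _),
        ← ENNReal.ofReal_mul (N.queueWeight_nonneg _ _), throughput, h0, h1, hs, zero_add]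
      congr 1
      have hq : N.queueWeight i (s i 1 + 1) = N.queueWeight i (s i 1) *
          (N.lam * N.p i / (N.μ * (N.c₂ * (min (N.m i) (s i 1 + 1) : ℕ)))) :=
        Finset.prod_range_succ _ _
      have hpos := (N.serviceRate_pos i (s i 1)).ne'
      have hn : ((s i 1 + 1 : ℕ) : ℝ) ≠ 0 := by positivity
      have hd : N.μ * (((s i 1 + 1 : ℕ) : ℝ) * ((min (N.m i) (s i 1 + 1) : ℕ) *
          (N.dataRate 1 / ((s i 1 + 1 : ℕ) : ℝ)))) =
          N.μ * (N.c₂ * (min (N.m i) (s i 1 + 1) : ℕ)) := by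
        rw [show N.dataRate 1 = N.c₂ from rfl]
        field_simp
      rw [hd, hq, mul_assoc, div_mul_cancel₀ _ hpos]
    · rw [if_neg hs, if_neg hs, zero_mul, zero_mul]

/-- Detailed balance: the chain is reversible with respect to `productWeight`. -/
theorem productWeight_reversible [NeZero B] (s s' : NetworkState B) :
    N.productWeight s * N.transitionRate (snrPolicy B) s s' =
      N.productWeight s' * N.transitionRate (snrPolicy B) s' s := by
  simp only [transitionRate, Finset.mul_sum]
  refine Finset.sum_congr rfl fun i _ => Finset.sum_congr rfl fun r _ => ?_
  rw [mul_add, mul_add, add_comm]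
  congr 1
  · split_ifs with h
    · rw [h, productWeight_mul_arrivalRate]
    · simp
  · split_ifs with h
    · rw [h, productWeight_mul_arrivalRate]
    · simp

theorem summable_queueWeight {i : Fin B} (h : N.lam * N.p i < N.μ * (N.c₂ * N.m i)) :
    Summable (N.queueWeight i) := by
  have hm : (0 : ℝ) < N.μ * (N.c₂ * N.m i) :=
    lt_of_le_of_lt (mul_nonneg N.lam_pos.le (N.p_nonneg i)) h
  refine summable_of_ratio_norm_eventually_le ((div_lt_one hm).2 h) ?_
  filter_upwards [Filter.eventually_ge_atTop (N.m i)] with n hn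
  rw [queueWeight, Finset.prod_range_succ, ← queueWeight, norm_mul, mul_comm,
    min_eq_left (by omega), Real.norm_of_nonneg
      (div_nonneg (mul_nonneg N.lam_pos.le (N.p_nonneg i)) hm.le)]

end Network

theorem ENNReal.tsum_prod_le {ι α : Type*} [Fintype ι] (f : ι → α → ℝ≥0∞) :
    ∑' x : ι → α, ∏ i, f i (x i) ≤ ∏ i, ∑' a, f i a := by
  classical
  rw [ENNReal.tsum_eq_iSup_sum]
  refine iSup_le fun F => ?_
  have hsub : F ⊆ Fintype.piFinset fun i => F.image fun x => x i := fun x hx =>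
    Fintype.mem_piFinset.2 fun i => Finset.mem_image_of_mem (fun x : ι → α => x i) hx
  refine (Finset.sum_le_sum_of_subset hsub).trans ?_
  rw [← Finset.prod_univ_sum]
  exact Finset.prod_le_prod' fun i _ => ENNReal.sum_le_tsum _

namespace Network

variable {B : ℕ} (N : Network B)

/-! ### Stability -/

theorem tsum_productWeight_ne_top (h : ∀ i, N.lam * N.p i < N.μ * (N.c₂ * N.m i)) :
    ∑' s, N.productWeight s ≠ ∞ := by
  refine ne_top_of_le_ne_top ?_ (ENNReal.tsum_prod_le fun i (v : Fin 2 → ℕ) =>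
    if v 0 = 0 then ENNReal.ofReal (N.queueWeight i (v 1)) else 0)
  refine ENNReal.prod_ne_top fun i _ => ?_
  rw [← (finTwoArrowEquiv ℕ).symm.tsum_eq]
  change ∑' c : ℕ × ℕ, (if c.1 = 0 then ENNReal.ofReal (N.queueWeight i c.2) else 0) ≠ ∞
  rw [ENNReal.tsum_prod (f := fun a b => if a = 0 then ENNReal.ofReal (N.queueWeight i b) else 0),
    tsum_eq_single 0]
  · simpa using (N.summable_queueWeight (h i)).tsum_ofReal_ne_top
  · intro a ha
    simp [ha]

theorem positiveRecurrent_of_productWeight_ne_zero [NeZero B]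
    (h : ∀ i, N.lam * N.p i < N.μ * (N.c₂ * N.m i)) {s : NetworkState B}
    (hs : N.productWeight s ≠ 0) : (N.ctmc (snrPolicy B)).PositiveRecurrent s := by
  refine TransitionRates.positiveRecurrent_of_subinvariant _ (π := N.productWeight) ?_
    (N.tsum_productWeight_ne_top h) ?_ hs
  · intro y
    rw [← ENNReal.tsum_mul_left]
    exact (tsum_congr fun x => N.productWeight_reversible x y).le
  · refine ne_top_of_le_ne_top
      (ENNReal.mul_ne_top (N.tsum_productWeight_ne_top h) N.exitBound_ne_top) ?_
    rw [← ENNReal.tsum_mul_right]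
    exact ENNReal.tsum_le_tsum fun x => mul_le_mul_right (N.tsum_transitionRate_le x) _

/-- Detailed balance carries positive weight along transitions. -/
theorem productWeight_ne_zero_of_reachable [NeZero B] {s : NetworkState B}
    (hs : (N.ctmc (snrPolicy B)).Reachable 0 s) : N.productWeight s ≠ 0 := by
  induction hs with
  | refl => simp [productWeight, queueWeight]
  | @tail a b _ hab ih =>
    intro hb
    have := N.productWeight_reversible a b
    rw [hb, zero_mul] at this
    exact mul_ne_zero ih hab this

/-- Stability means that the offered load of each BS is below its capacity. -/
theorem isStable_snrPolicy_iff [NeZero B] :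
    N.IsStable (snrPolicy B) ↔ ∀ i, N.lam * N.p i < N.μ * (N.c₂ * N.m i) := by
  constructor
  · intro h i
    by_contra! hi
    exact N.not_positiveRecurrent_zero hi (h 0 .refl)
  · intro h s hs
    exact N.positiveRecurrent_of_productWeight_ne_zero h (N.productWeight_ne_zero_of_reachable hs)

theorem lam_lt_mul_iInf_iff [NeZero B] :
    ENNReal.ofReal N.lam < ENNReal.ofReal N.μ * ENNReal.ofReal N.c₂ *
        ⨅ i : Fin B, (N.m i : ℝ≥0∞) / ENNReal.ofReal (N.p i) ↔
      ∀ i, N.lam * N.p i < N.μ * (N.c₂ * N.m i) := by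
  have hc : 0 < N.c₂ := zero_lt_one.trans N.one_lt_c₂
  have hcμ : 0 < N.μ * N.c₂ := mul_pos N.μ_pos hc
  have key : ∀ i, ENNReal.ofReal N.lam < ENNReal.ofReal N.μ * ENNReal.ofReal N.c₂ *
      ((N.m i : ℝ≥0∞) / ENNReal.ofReal (N.p i)) ↔ N.lam * N.p i < N.μ * (N.c₂ * N.m i) := by
    intro i
    have hm : (0 : ℝ) < N.m i := by exact_mod_cast N.one_le_m i
    rw [← ENNReal.ofReal_mul N.μ_pos.le]
    rcases (N.p_nonneg i).eq_or_lt with hp | hp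
    · have h0 : (N.m i : ℝ≥0∞) ≠ 0 := by
        have := N.one_le_m i
        exact_mod_cast (by omega : N.m i ≠ 0)
      rw [← hp, ENNReal.ofReal_zero, ENNReal.div_zero h0,
        ENNReal.mul_top (ENNReal.ofReal_pos.2 hcμ).ne', mul_zero]
      exact ⟨fun _ => mul_pos N.μ_pos (mul_pos hc hm), fun _ => ENNReal.ofReal_lt_top⟩
    · rw [← ENNReal.ofReal_natCast, ← ENNReal.ofReal_div_of_pos hp, ← ENNReal.ofReal_mul hcμ.le,
        ENNReal.ofReal_lt_ofReal_iff (mul_pos hcμ (div_pos hm hp)), ← mul_div_assoc,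
        lt_div_iff₀ hp, mul_assoc N.μ]
  obtain ⟨i, hi⟩ := exists_eq_ciInf_of_finite
    (f := fun i : Fin B => (N.m i : ℝ≥0∞) / ENNReal.ofReal (N.p i))
  constructor
  · intro h j
    refine (key j).1 (h.trans_le ?_)
    gcongr
    exact iInf_le _ j
  · intro h
    rw [← hi]
    exact (key i).2 (h i)

end Network

theorem mainTheorem1 {B : ℕ} [B.AtLeastTwo] (N : Network B) :
    N.IsStable (snrPolicy B) ↔
      ENNReal.ofReal N.lam <
        ENNReal.ofReal N.μ * ENNReal.ofReal N.c₂ *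
          ⨅ i : Fin B, (N.m i : ℝ≥0∞) / ENNReal.ofReal (N.p i) :=
  N.isStable_snrPolicy_iff.trans N.lam_lt_mul_iInf_iff.symm
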